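/- **Theorem (perfect parallel repetition for XOR games).** An XOR game $G=(f,\pi)$ consists of finite sets $S,T$, a predicate $f:S\times T\to\{0,1\}$ and a probability distribution $\pi$ on $S\times T$: the verifier draws $(s,t)\sim\pi$, sends $s$ to Alice and $t$ to Bob, receives bits $a$ from Alice and $b$ from Bob, and accepts if and only if $a\oplus b=f(s,t)$. The conjunction $\bigwedge_{j=1}^n G_j$ of XOR games $G_j=(f_j,\pi_j)$ on $S_j\times T_j$ is the game in which $((s_1,t_1),\dots,(s_n,t_n))$ is drawn from $\pi_1\times\cdots\times\pi_n$, Alice receives $(s_1,\dots,s_n)$ and answers with bits $a_1,\dots,a_n$, Bob receives $(t_1,\dots,t_n)$ and answers with bits $b_1,\dots,b_n$, and they win if and only if $a_j\oplus b_j=f_j(s_j,t_j)$ for all $j$. A quantum strategy consists of a unit vector $|\psi\rangle\in\mathcal A\otimes\mathcal B$, where $\mathcal A,\mathcal B$ are finite-dimensional complex Hilbert spaces, a measurement (POVM) $\{X_s^a\}_a$ on $\mathcal A$ for every question $s$ to Alice, and a measurement $\{Y_t^b\}_b$ on $\mathcal B$ for every question $t$ to Bob; on questions $(s,t)$ the answers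 are $(a,b)$ with probability $\langle\psi|X_s^a\otimes Y_t^b|\psi\rangle$. The quantum value $\omega_q$ of a game is the maximum success probability over all quantum strategies (of all finite dimensions). For any XOR games $G_1,\dots,G_n$, the maxima defining $\omega_q(G_1),\dots,\omega_q(G_n)$ and $\omega_q(\bigwedge_{j=1}^n G_j)$ are attained, and $$\omega_q\Bigl(\bigwedge_{j=1}^n G_j\Bigr)=\prod_{j=1}^n\omega_q(G_j).$$ -/

import Mathlib

open scoped Kronecker ComplexOrder

/-- A one-round two-player game with finite question sets `S`, `T` and answer sets `A`, `B`:
the verifier draws `(s, t)` with probability `prob s t`, and accepts the answers `(a, b)`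
if and only if `accept s t a b = true`. -/
structure TwoPlayerGame (S T A B : Type*) [Fintype S] [Fintype T] where
  prob : S → T → ℝ
  prob_nonneg : ∀ s t, 0 ≤ prob s t
  prob_sum : ∑ s, ∑ t, prob s t = 1
  accept : S → T → A → B → Bool

/-- An XOR game `(f, π)`: a predicate `f` on `S × T` and a probability distribution `π`
on `S × T`. -/
structure XORGame (S T : Type*) [Fintype S] [Fintype T] where
  f : S → T → Bool
  prob : S → T → ℝ
  prob_nonneg : ∀ s t, 0 ≤ prob s t
  prob_sum : ∑ s, ∑ t, prob s t = 1

/-- The two-player game described by an XOR game: the players answer with one bit each and win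
if and only if `a ⊕ b = f s t`. -/
def XORGame.toGame {S T : Type*} [Fintype S] [Fintype T] (G : XORGame S T) :
    TwoPlayerGame S T Bool Bool where
  prob := G.prob
  prob_nonneg := G.prob_nonneg
  prob_sum := G.prob_sum
  accept s t a b := decide (Bool.xor a b = G.f s t)

/-- The conjunction of the XOR games `G 0, …, G (n - 1)`: the questions are drawn from the product
distribution, Alice receives all the `s j` and Bob all the `t j`, each of them answers with `n`
bits, and they win if and only if `a j ⊕ b j = f j (s j) (t j)` for every `j`. -/
def XORGame.conjunction {n : ℕ} {S T : Fin n → Type*} [∀ j, Fintype (S j)] [∀ j, Fintype (T j)]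
    (G : ∀ j, XORGame (S j) (T j)) :
    TwoPlayerGame (∀ j, S j) (∀ j, T j) (Fin n → Bool) (Fin n → Bool) where
  prob s t := ∏ j, (G j).prob (s j) (t j)
  prob_nonneg s t := Finset.prod_nonneg fun j _ => (G j).prob_nonneg (s j) (t j)
  prob_sum := by
    have h : ∀ s : (∀ j, S j), ∑ t : (∀ j, T j), ∏ j, (G j).prob (s j) (t j)
        = ∏ j, ∑ t, (G j).prob (s j) t := fun s =>
      (Fintype.prod_sum fun j t => (G j).prob (s j) t).symm
    simp only [h]
    rw [← Fintype.prod_sum fun j s => ∑ t, (G j).prob s t]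
    simp [(G _).prob_sum]
  accept s t a b := decide (∀ j, Bool.xor (a j) (b j) = (G j).f (s j) (t j))

/-- A measurement (POVM) with outcomes in `A` on the space `ℂ^ι`. -/
structure POVM (A ι : Type*) [Fintype A] [Fintype ι] [DecidableEq ι] where
  effect : A → Matrix ι ι ℂ
  posSemidef : ∀ a, (effect a).PosSemidef
  sum_eq_one : ∑ a, effect a = 1

/-- A quantum strategy with local spaces `ℂ^ι` (Alice) and `ℂ^κ` (Bob): a shared unit vector in
`ℂ^ι ⊗ ℂ^κ = ℂ^(ι × κ)`, and for each question a measurement by the player who receives it on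
that player's part of the state. -/
structure QuantumStrategy (S T A B ι κ : Type*) [Fintype A] [Fintype B]
    [Fintype ι] [DecidableEq ι] [Fintype κ] [DecidableEq κ] where
  state : ι × κ → ℂ
  state_unit : star state ⬝ᵥ state = 1
  alice : S → POVM A ι
  bob : T → POVM B κ

section Strategy

variable {S T A B ι κ : Type*} [Fintype S] [Fintype T] [Fintype A] [Fintype B]
  [Fintype ι] [DecidableEq ι] [Fintype κ] [DecidableEq κ]

/-- The probability `⟨ψ| X_s^a ⊗ Y_t^b |ψ⟩` that the answers are `(a, b)` when the questions
are `(s, t)`. -/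
noncomputable def QuantumStrategy.answerProb (σ : QuantumStrategy S T A B ι κ)
    (s : S) (t : T) (a : A) (b : B) : ℝ :=
  (star σ.state ⬝ᵥ (((σ.alice s).effect a ⊗ₖ (σ.bob t).effect b).mulVec σ.state)).re

/-- The success probability of a quantum strategy on a game. -/
noncomputable def QuantumStrategy.successProb (σ : QuantumStrategy S T A B ι κ)
    (G : TwoPlayerGame S T A B) : ℝ :=
  ∑ s, ∑ t, G.prob s t *
    ∑ a, ∑ b, if G.accept s t a b = true then σ.answerProb s t a b else 0

end Strategy

/-- The set of the success probabilities of all quantum strategies for `G`, with local spaces of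
arbitrary finite dimensions. -/
def TwoPlayerGame.quantumSuccessProbs {S T A B : Type*} [Fintype S] [Fintype T]
    [Fintype A] [Fintype B] (G : TwoPlayerGame S T A B) : Set ℝ :=
  {p | ∃ (ι κ : Type) (_ : Fintype ι) (_ : DecidableEq ι) (_ : Fintype κ) (_ : DecidableEq κ)
    (σ : QuantumStrategy S T A B ι κ), σ.successProb G = p}

/-- The quantum value of a game. -/
noncomputable def TwoPlayerGame.quantumValue {S T A B : Type*} [Fintype S] [Fintype T]
    [Fintype A] [Fintype B] (G : TwoPlayerGame S T A B) : ℝ :=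
  sSup G.quantumSuccessProbs

/-!
By Tsirelson's theorem the optimal bias of an XOR game is the maximum of
`∑ s t, π(s, t) (-1) ^ f(s, t) ⟨u s, v t⟩` over families of unit vectors. This is a semidefinite
program; stationarity at a maximiser yields a dual solution of the same value, and the optimal
vectors become observables `±1` on a maximally entangled state through a representation of a
Clifford algebra.

For a conjunction, expand the indicator of winning all games in the characters of the group of bit
strings: the success probability is the average over the sets `M` of games of the bias with which
the players play the XOR of the games in `M`. Dual solutions multiply under Kronecker products, so
that bias is at most the product of the biases `ε j`, `j ∈ M`, and the average is at most
`2 ^ (-n) * ∑ M, ∏ j ∈ M, ε j = ∏ j, (1 + ε j) / 2`, which independent optimal strategies attain.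
-/

open Matrix WithLp
open scoped RealInnerProductSpace

section PiKronecker

variable {J : Type*} [Fintype J] {m n : J → Type*}

/-- The Kronecker product of a finite family of matrices. -/
def piKronecker {R : Type*} [CommMonoid R] (N : ∀ j, Matrix (m j) (n j) R) :
    Matrix (∀ j, m j) (∀ j, n j) R :=
  of fun a b => ∏ j, N j (a j) (b j)

theorem piKronecker_apply {R : Type*} [CommMonoid R] (N : ∀ j, Matrix (m j) (n j) R)
    (a : ∀ j, m j) (b : ∀ j, n j) : piKronecker N a b = ∏ j, N j (a j) (b j) := rfl

theorem piKronecker_diagonal {R : Type*} [CommMonoidWithZero R] [∀ j, DecidableEq (m j)]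
    (d : ∀ j, m j → R) :
    piKronecker (fun j => diagonal (d j)) = diagonal fun a => ∏ j, d j (a j) := by
  ext a b
  simp only [piKronecker_apply, diagonal_apply, Finset.prod_ite_zero, Finset.mem_univ,
    forall_const, funext_iff]

theorem piKronecker_one {R : Type*} [CommMonoidWithZero R] [∀ j, DecidableEq (m j)] :
    piKronecker (fun j => (1 : Matrix (m j) (m j) R)) = 1 := by
  simpa only [Finset.prod_const_one, diagonal_one] using
    piKronecker_diagonal (m := m) fun _ _ => (1 : R)

theorem sum_piKronecker {R : Type*} [CommSemiring R] {A : J → Type*} [∀ j, Fintype (A j)]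
    [DecidableEq J] (N : ∀ j, A j → Matrix (m j) (n j) R) :
    ∑ a : ∀ j, A j, piKronecker (fun j => N j (a j)) = piKronecker fun j => ∑ a, N j a := by
  ext x y
  simp only [Matrix.sum_apply, piKronecker_apply, Fintype.prod_sum]

variable {𝕜 : Type*} [RCLike 𝕜]

theorem posSemidef_prod_hadamard {J m : Type*} (s : Finset J) {N : J → Matrix m m 𝕜}
    (hN : ∀ j ∈ s, (N j).PosSemidef) : (of fun a b => ∏ j ∈ s, N j a b).PosSemidef := by
  classical
  induction s using Finset.induction_on with
  | empty =>
    have h : (of fun a b => ∏ j ∈ (∅ : Finset J), N j a b)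
        = (1 : Matrix Unit Unit 𝕜).submatrix (fun _ : m => ()) (fun _ => ()) := by
      ext a b; simp
    exact h ▸ PosSemidef.one.submatrix _
  | insert j s hj ih =>
    have h : (of fun a b => ∏ i ∈ insert j s, N i a b) = N j ⊙ of fun a b => ∏ i ∈ s, N i a b := by
      ext a b
      simp only [of_apply, hadamard_apply, Finset.prod_insert hj]
    exact h ▸ (hN j (s.mem_insert_self j)).hadamard
      (ih fun i hi => hN i (Finset.mem_insert_of_mem hi))

theorem posSemidef_piKronecker {N : ∀ j, Matrix (m j) (m j) 𝕜} (hN : ∀ j, (N j).PosSemidef) :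
    (piKronecker N).PosSemidef :=
  posSemidef_prod_hadamard Finset.univ
    (N := fun j => (N j).submatrix (fun a : ∀ j, m j => a j) fun a => a j)
    fun j _ => (hN j).submatrix _

end PiKronecker

section DualBound

variable {S T : Type*}

/-- The pairing of a cost matrix with a matrix of correlations, as in the bias
`∑ s t, π(s, t) (-1) ^ f(s, t) ⟨u s, v t⟩` of an XOR game. -/
def correlationValue [Fintype S] [Fintype T] (C K : Matrix S T ℝ) : ℝ :=
  ∑ s, ∑ t, C s t * K s t

variable [DecidableEq S] [DecidableEq T]

/-- The slack matrix of the semidefinite program dual to the maximisation of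
`∑ s t, C s t * ⟨u s, v t⟩` over unit vectors. Flipping the sign of `C` does not affect
positivity; with this sign slack matrices are multiplicative under Kronecker products. -/
def dualSlack (C : Matrix S T ℝ) (p : S → ℝ) (q : T → ℝ) : Matrix (S ⊕ T) (S ⊕ T) ℝ :=
  fromBlocks (diagonal p) C Cᵀ (diagonal q)

theorem isHermitian_dualSlack (C : Matrix S T ℝ) (p : S → ℝ) (q : T → ℝ) :
    (dualSlack C p q).IsHermitian := by
  simp [IsHermitian, dualSlack, conjTranspose_eq_transpose_of_trivial, fromBlocks_transpose]

theorem sum_dualSlack_mul_of_isSymm [Fintype S] [Fintype T] (C : Matrix S T ℝ) (p : S → ℝ)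
    (q : T → ℝ) {K : Matrix (S ⊕ T) (S ⊕ T) ℝ} (hK : K.IsSymm) :
    ∑ a, ∑ b, dualSlack C p q a b * K a b =
      ∑ s, p s * K (.inl s) (.inl s) + 2 * correlationValue C K.toBlocks₁₂ +
        ∑ t, q t * K (.inr t) (.inr t) := by
  have hsymm : ∑ t, ∑ s, C s t * K (.inr t) (.inl s) = correlationValue C K.toBlocks₁₂ := by
    rw [Finset.sum_comm]
    simp only [hK.apply, correlationValue, toBlocks₁₂, of_apply]
  simp only [dualSlack, Fintype.sum_sum_type, fromBlocks_apply₁₁, fromBlocks_apply₁₂,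
    fromBlocks_apply₂₁, fromBlocks_apply₂₂, diagonal_apply, ite_mul, zero_mul, Finset.sum_ite_eq,
    Finset.mem_univ, if_true, transpose_apply, Finset.sum_add_distrib, hsymm]
  simp only [correlationValue, toBlocks₁₂, of_apply]
  ring

theorem dualSlack_piKronecker {J : Type*} [Fintype J] {S T : J → Type*}
    [∀ j, DecidableEq (S j)] [∀ j, DecidableEq (T j)] (C : ∀ j, Matrix (S j) (T j) ℝ)
    (p : ∀ j, S j → ℝ) (q : ∀ j, T j → ℝ) :
    dualSlack (piKronecker C) (fun s => ∏ j, p j (s j)) (fun t => ∏ j, q j (t j)) =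
      (piKronecker fun j => dualSlack (C j) (p j) (q j)).submatrix
        (fun a j => Sum.map (· j) (· j) a) (fun a j => Sum.map (· j) (· j) a) := by
  rw [dualSlack, ← piKronecker_diagonal, ← piKronecker_diagonal]
  ext (s | t) (s' | t') <;> rfl

/-- A feasible dual solution, balanced between the two players, showing that
`∑ s t, C s t * ⟨u s, v t⟩ ≤ e` for all vectors `u s`, `v t` in the unit ball. -/
def IsDualBound [Fintype S] [Fintype T] (C : Matrix S T ℝ) (e : ℝ) : Prop :=
  ∃ (p : S → ℝ) (q : T → ℝ), (dualSlack C p q).PosSemidef ∧ ∑ s, p s = e ∧ ∑ t, q t = e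

theorem IsDualBound.piKronecker {J : Type*} [Fintype J] [DecidableEq J] {S T : J → Type*}
    [∀ j, Fintype (S j)] [∀ j, Fintype (T j)] [∀ j, DecidableEq (S j)] [∀ j, DecidableEq (T j)]
    {C : ∀ j, Matrix (S j) (T j) ℝ} {e : J → ℝ} (h : ∀ j, IsDualBound (C j) (e j)) :
    IsDualBound (piKronecker C) (∏ j, e j) := by
  choose p q hpq hp hq using h
  refine ⟨fun s => ∏ j, p j (s j), fun t => ∏ j, q j (t j), ?_, ?_, ?_⟩
  · rw [dualSlack_piKronecker]
    exact (posSemidef_piKronecker hpq).submatrix _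
  · simp only [← Fintype.prod_sum, hp]
  · simp only [← Fintype.prod_sum, hq]

variable [Fintype S] [Fintype T]

/-- `h` says that the slack matrix whose diagonal holds the row and column sums of `C ⊙ K` has a
nonnegative quadratic form. -/
theorem isDualBound_correlationValue {C K : Matrix S T ℝ}
    (h : ∀ (x : S → ℝ) (y : T → ℝ),
      0 ≤ ∑ s, ∑ t, C s t * (K s t * (x s ^ 2 + y t ^ 2) + 2 * (x s * y t))) :
    IsDualBound C (correlationValue C K) := by
  refine ⟨fun s => ∑ t, C s t * K s t, fun t => ∑ s, C s t * K s t,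
    .of_dotProduct_mulVec_nonneg (isHermitian_dualSlack _ _ _) fun z => ?_, rfl, Finset.sum_comm⟩
  set p : S → ℝ := fun s => ∑ t, C s t * K s t
  set q : T → ℝ := fun t => ∑ s, C s t * K s t
  have hsymm : (vecMulVec z z).IsSymm := transpose_vecMulVec z z
  have hq : ∑ t, q t * (z (.inr t) * z (.inr t)) =
      ∑ s, ∑ t, C s t * K s t * (z (.inr t) * z (.inr t)) := by
    simp only [q, Finset.sum_mul]
    exact Finset.sum_comm
  calc 0 ≤ ∑ s, ∑ t, C s t * (K s t * (z (.inl s) ^ 2 + z (.inr t) ^ 2) +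
        2 * (z (.inl s) * z (.inr t))) := h (z ∘ .inl) (z ∘ .inr)
    _ = ∑ s, p s * vecMulVec z z (.inl s) (.inl s) +
        2 * correlationValue C (vecMulVec z z).toBlocks₁₂ +
        ∑ t, q t * vecMulVec z z (.inr t) (.inr t) := by
      simp only [vecMulVec_apply, hq, correlationValue, toBlocks₁₂, of_apply, p, Finset.sum_mul,
        Finset.mul_sum, ← Finset.sum_add_distrib]
      exact Finset.sum_congr rfl fun _ _ => Finset.sum_congr rfl fun _ _ => by ring
    _ = ∑ a, ∑ b, dualSlack C p q a b * vecMulVec z z a b :=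
      (sum_dualSlack_mul_of_isSymm C p q hsymm).symm
    _ = star z ⬝ᵥ (dualSlack C p q *ᵥ z) := by
      simp only [dotProduct, mulVec, star_trivial, vecMulVec_apply, Finset.mul_sum]
      exact Finset.sum_congr rfl fun _ _ => Finset.sum_congr rfl fun _ _ => by ring

theorem isDualBound_sum_of_nonneg {C : Matrix S T ℝ} (hC : ∀ s t, 0 ≤ C s t) :
    IsDualBound C (∑ s, ∑ t, C s t) := by
  have h : IsDualBound C (correlationValue C fun _ _ => 1) :=
    isDualBound_correlationValue fun x y => Finset.sum_nonneg fun s _ =>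
      Finset.sum_nonneg fun t _ => mul_nonneg (hC s t) (by linarith [sq_nonneg (x s + y t)])
  simpa only [correlationValue, mul_one] using h

theorem sum_mul_inner_nonneg {m E : Type*} [Fintype m] [NormedAddCommGroup E]
    [InnerProductSpace ℝ E] {N : Matrix m m ℝ} (hN : N.PosSemidef) (w : m → E) :
    0 ≤ ∑ a, ∑ b, N a b * ⟪w a, w b⟫ := by
  simpa [dotProduct, mulVec, gram_apply] using
    (hN.hadamard (posSemidef_gram ℝ w)).dotProduct_mulVec_nonneg 1

theorem IsDualBound.correlationValue_inner_le {E : Type*} [NormedAddCommGroup E]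
    [InnerProductSpace ℝ E] {C : Matrix S T ℝ} {e : ℝ} (h : IsDualBound C e) {u : S → E}
    {v : T → E} (hu : ∀ s, ‖u s‖ ≤ 1) (hv : ∀ t, ‖v t‖ ≤ 1) :
    correlationValue C (of fun s t => ⟪u s, v t⟫) ≤ e := by
  obtain ⟨p, q, hpq, hp, hq⟩ := h
  have hp_nonneg (s) : 0 ≤ p s := by simpa [dualSlack] using hpq.diag_nonneg (i := .inl s)
  have hq_nonneg (t) : 0 ≤ q t := by simpa [dualSlack] using hpq.diag_nonneg (i := .inr t)
  have hslack : 0 ≤ ∑ s, p s * ‖u s‖ ^ 2 - 2 * correlationValue C (of fun s t => ⟪u s, v t⟫) +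
      ∑ t, q t * ‖v t‖ ^ 2 := by
    have hsymm : (gram ℝ (Sum.elim (-u) v)).IsSymm := by
      ext a b
      exact real_inner_comm _ _
    have hsum := sum_mul_inner_nonneg hpq (Sum.elim (-u) v)
    simp only [← gram_apply] at hsum
    rw [sum_dualSlack_mul_of_isSymm C p q hsymm] at hsum
    simpa [correlationValue, toBlocks₁₂, gram_apply, sub_eq_add_neg] using hsum
  have hpu : ∑ s, p s * ‖u s‖ ^ 2 ≤ ∑ s, p s := Finset.sum_le_sum fun s _ =>
    mul_le_of_le_one_right (hp_nonneg s) (pow_le_one₀ (norm_nonneg _) (hu s))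
  have hqv : ∑ t, q t * ‖v t‖ ^ 2 ≤ ∑ t, q t := Finset.sum_le_sum fun t _ =>
    mul_le_of_le_one_right (hq_nonneg t) (pow_le_one₀ (norm_nonneg _) (hv t))
  linarith

theorem IsDualBound.correlationValue_re_inner_le {𝕜 E : Type*} [RCLike 𝕜] [NormedAddCommGroup E]
    [InnerProductSpace 𝕜 E] {C : Matrix S T ℝ} {e : ℝ} (h : IsDualBound C e) {u : S → E}
    {v : T → E} (hu : ∀ s, ‖u s‖ ≤ 1) (hv : ∀ t, ‖v t‖ ≤ 1) :
    correlationValue C (of fun s t => RCLike.re (inner 𝕜 (u s) (v t))) ≤ e := by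
  let _ := InnerProductSpace.rclikeToReal 𝕜 E
  simpa only [real_inner_eq_re_inner 𝕜] using h.correlationValue_inner_le hu hv

end DualBound

section CorrelationMatrices

variable {m : Type*}

/-- The correlation matrices, that is, the Gram matrices of families of unit vectors. -/
def correlationMatrices (m : Type*) : Set (Matrix m m ℝ) :=
  {R | R.PosSemidef ∧ ∀ a, R a a = 1}

theorem correlationMatrices_nonempty : (correlationMatrices m).Nonempty := by
  classical exact ⟨1, PosSemidef.one, one_apply_eq⟩

theorem abs_le_one_of_mem_correlationMatrices {R : Matrix m m ℝ}
    (hR : R ∈ correlationMatrices m) (a b : m) : |R a b| ≤ 1 := by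
  have hsymm : R b a = R a b := hR.1.isHermitian.apply a b
  have hdet := (hR.1.submatrix ![a, b]).det_nonneg
  simp only [det_fin_two, submatrix_apply, cons_val_zero, cons_val_one, hR.2, hsymm] at hdet
  exact (sq_le_one_iff_abs_le_one _).1 (by linarith)

theorem isCompact_correlationMatrices [Finite m] : IsCompact (correlationMatrices m) := by
  have := Fintype.ofFinite m
  have hsub : correlationMatrices m ⊆
      Set.univ.pi fun _ : m => Set.univ.pi fun _ : m => Set.Icc (-1 : ℝ) 1 := fun R hR a _ b _ =>
    abs_le.1 (abs_le_one_of_mem_correlationMatrices hR a b)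
  have heq : correlationMatrices m = {R : Matrix m m ℝ | Rᴴ = R} ∩
      (⋂ x : m → ℝ, {R | 0 ≤ star x ⬝ᵥ (R *ᵥ x)}) ∩ ⋂ a, {R | R a a = 1} := by
    ext R
    simp [correlationMatrices, posSemidef_iff_dotProduct_mulVec, IsHermitian]
  refine (isCompact_univ_pi fun _ => isCompact_univ_pi fun _ => isCompact_Icc).of_isClosed_subset
    (heq ▸ ?_) hsub
  exact ((isClosed_eq (by fun_prop) continuous_id).inter
    (isClosed_iInter fun x => isClosed_le continuous_const
      (continuous_const.dotProduct (continuous_id.matrix_mulVec continuous_const)))).inter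
    (isClosed_iInter fun a => isClosed_eq (continuous_id.matrix_elem a a) continuous_const)

/-- The correlation matrix obtained from the unit vectors with Gram matrix `R` by adding to the
vector of index `a` the component `√h * z a` along one new direction, and renormalising. -/
noncomputable def tiltCorrelation (R : Matrix m m ℝ) (z : m → ℝ) (h : ℝ) : Matrix m m ℝ :=
  of fun a b => (R a b + h * (z a * z b)) * ((√(1 + h * z a ^ 2))⁻¹ * (√(1 + h * z b ^ 2))⁻¹)

theorem tiltCorrelation_zero (R : Matrix m m ℝ) (z : m → ℝ) : tiltCorrelation R z 0 = R := by
  ext a b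
  simp [tiltCorrelation]

theorem tiltCorrelation_mem [Finite m] {R : Matrix m m ℝ} (hR : R ∈ correlationMatrices m)
    (z : m → ℝ) {h : ℝ} (hh : 0 ≤ h) : tiltCorrelation R z h ∈ correlationMatrices m := by
  set d : m → ℝ := fun a => (√(1 + h * z a ^ 2))⁻¹
  refine ⟨(hR.1.add ((posSemidef_vecMulVec_self_star z).smul hh)).hadamard
    (posSemidef_vecMulVec_self_star d), fun a => ?_⟩
  have hpos : 0 < 1 + h * z a ^ 2 := by positivity
  rw [tiltCorrelation, of_apply, hR.2, ← mul_inv, Real.mul_self_sqrt hpos.le, ← sq,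
    mul_inv_cancel₀ hpos.ne']

theorem hasDerivAt_inv_sqrt_one_add_mul (c : ℝ) :
    HasDerivAt (fun h : ℝ => (√(1 + h * c))⁻¹) (-c / 2) 0 := by
  have hlin : HasDerivAt (fun h : ℝ => 1 + h * c) c 0 := by
    simpa using ((hasDerivAt_id (0 : ℝ)).mul_const c).const_add 1
  exact ((hlin.sqrt (by simp)).fun_inv (by simp)).congr_deriv (by simp; ring)

theorem hasDerivAt_tiltCorrelation_apply (R : Matrix m m ℝ) (z : m → ℝ) (a b : m) :
    HasDerivAt (fun h => tiltCorrelation R z h a b)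
      (z a * z b - (z a ^ 2 + z b ^ 2) / 2 * R a b) 0 := by
  have hlin : HasDerivAt (fun h => R a b + h * (z a * z b)) (z a * z b) 0 := by
    simpa using ((hasDerivAt_id (0 : ℝ)).mul_const (z a * z b)).const_add (R a b)
  exact (hlin.mul ((hasDerivAt_inv_sqrt_one_add_mul (z a ^ 2)).mul
    (hasDerivAt_inv_sqrt_one_add_mul (z b ^ 2)))).congr_deriv (by simp; ring)

theorem hasDerivAt_nonpos_of_isMaxOn_Ici {F : ℝ → ℝ} {F' a : ℝ} (hF : HasDerivAt F F' a)
    (hmax : IsMaxOn F (Set.Ici a) a) : F' ≤ 0 := by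
  have hcone : (1 : ℝ) ∈ posTangentConeAt (Set.Ici a) a :=
    mem_posTangentConeAt_of_segment_subset ((segment_eq_Icc (by simp)).trans_subset
      Set.Icc_subset_Ici_self)
  simpa using hmax.localize.hasFDerivWithinAt_nonpos hF.hasDerivWithinAt.hasFDerivWithinAt hcone

end CorrelationMatrices

section StrongDuality

variable {S T : Type*} [Fintype S] [Fintype T]

/-- The maximum of `∑ s t, C s t * ⟨u s, v t⟩` over all families of unit vectors `u s`, `v t`. -/
noncomputable def maxCorrelation (C : Matrix S T ℝ) : ℝ :=
  sSup ((fun R => correlationValue C R.toBlocks₁₂) '' correlationMatrices (S ⊕ T))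

theorem exists_correlationValue_eq_maxCorrelation (C : Matrix S T ℝ) :
    ∃ R ∈ correlationMatrices (S ⊕ T), correlationValue C R.toBlocks₁₂ = maxCorrelation C ∧
      IsMaxOn (fun R => correlationValue C R.toBlocks₁₂) (correlationMatrices (S ⊕ T)) R := by
  have hcont : Continuous fun R : Matrix (S ⊕ T) (S ⊕ T) ℝ => correlationValue C R.toBlocks₁₂ :=
    continuous_finsetSum _ fun s _ => continuous_finsetSum _ fun t _ =>
      continuous_const.mul (continuous_id.matrix_elem (Sum.inl s) (Sum.inr t))
  obtain ⟨R, hR, hsup, hmax⟩ := isCompact_correlationMatrices.exists_sSup_image_eq_and_ge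
    correlationMatrices_nonempty hcont.continuousOn
  exact ⟨R, hR, hsup.symm, hmax⟩

variable [DecidableEq S] [DecidableEq T]

/-- Stationarity of a maximiser under `tiltCorrelation` is exactly dual feasibility. -/
theorem isDualBound_maxCorrelation (C : Matrix S T ℝ) : IsDualBound C (maxCorrelation C) := by
  obtain ⟨R, hR, hsup, hmax⟩ := exists_correlationValue_eq_maxCorrelation C
  refine hsup ▸ isDualBound_correlationValue fun x y => ?_
  set z : S ⊕ T → ℝ := Sum.elim x (-y) with hz
  have hderiv : HasDerivAt (fun h => correlationValue C (tiltCorrelation R z h).toBlocks₁₂)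
      (∑ s, ∑ t, C s t * (z (.inl s) * z (.inr t) -
        (z (.inl s) ^ 2 + z (.inr t) ^ 2) / 2 * R (.inl s) (.inr t))) 0 :=
    HasDerivAt.fun_sum fun s _ => HasDerivAt.fun_sum fun t _ =>
      (hasDerivAt_tiltCorrelation_apply R z (.inl s) (.inr t)).const_mul (C s t)
  have hstat := hasDerivAt_nonpos_of_isMaxOn_Ici hderiv fun h hh => by
    simpa only [Set.mem_ofPred_eq, tiltCorrelation_zero] using hmax (tiltCorrelation_mem hR z hh)
  calc 0 ≤ -2 * ∑ s, ∑ t, C s t * (z (.inl s) * z (.inr t) -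
        (z (.inl s) ^ 2 + z (.inr t) ^ 2) / 2 * R (.inl s) (.inr t)) :=
      mul_nonneg_of_nonpos_of_nonpos (by norm_num) hstat
    _ = _ := by
      simp only [hz, Sum.elim_inl, Sum.elim_inr, Pi.neg_apply, toBlocks₁₂, of_apply,
        Finset.mul_sum]
      exact Finset.sum_congr rfl fun _ _ => Finset.sum_congr rfl fun _ _ => by ring

end StrongDuality

section Observable

variable {𝕜 m : Type*} [RCLike 𝕜] [Fintype m]

theorem norm_toLp_sq (ψ : m → 𝕜) : ‖toLp 2 ψ‖ ^ 2 = RCLike.re (star ψ ⬝ᵥ ψ) := by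
  rw [← inner_self_eq_norm_sq (𝕜 := 𝕜), EuclideanSpace.inner_toLp_toLp, dotProduct_comm]

variable [DecidableEq m]

theorem posSemidef_one_sub_mul_self {X : Matrix m m 𝕜} (h₁ : (1 - X).PosSemidef)
    (h₂ : (1 + X).PosSemidef) : (1 - X * X).PosSemidef := by
  have heq : (2 : 𝕜) • (1 - X * X) =
      (1 + X)ᴴ * (1 - X) * (1 + X) + (1 - X)ᴴ * (1 + X) * (1 - X) := by
    rw [h₁.isHermitian.eq, h₂.isHermitian.eq, two_smul]
    noncomm_ring
  have hsum := (h₁.conjTranspose_mul_mul_same (1 + X)).add (h₂.conjTranspose_mul_mul_same (1 - X))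
  rw [← inv_smul_smul₀ (two_ne_zero (α := 𝕜)) (1 - X * X), heq]
  exact hsum.smul (by positivity)

theorem norm_toLp_mulVec_le {X : Matrix m m 𝕜} (h₁ : (1 - X).PosSemidef)
    (h₂ : (1 + X).PosSemidef) (ψ : m → 𝕜) : ‖toLp 2 (X *ᵥ ψ)‖ ≤ ‖toLp 2 ψ‖ := by
  have hX : X.IsHermitian := by simpa using isHermitian_one.sub h₁.isHermitian
  have hψ := (posSemidef_one_sub_mul_self h₁ h₂).re_dotProduct_nonneg ψ
  rw [sub_mulVec, dotProduct_sub, one_mulVec, map_sub, sub_nonneg, ← mulVec_mulVec,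
    dotProduct_mulVec] at hψ
  rwa [← sq_le_sq₀ (norm_nonneg _) (norm_nonneg _), norm_toLp_sq, norm_toLp_sq, star_mulVec, hX.eq]

variable {A ι : Type*} [Fintype A] [Fintype ι] [DecidableEq ι]

/-- The observable of a measurement whose outcome `a` is given the real value `α a`. -/
noncomputable def POVM.observable (E : POVM A ι) (α : A → ℝ) : Matrix ι ι ℂ :=
  ∑ a, (α a : ℂ) • E.effect a

theorem POVM.isHermitian_observable (E : POVM A ι) (α : A → ℝ) :
    (E.observable α).IsHermitian :=
  isSelfAdjoint_sum _ fun a _ =>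
    IsSelfAdjoint.smul (Complex.conj_ofReal _) (E.posSemidef a).isHermitian

theorem POVM.observable_const_one (E : POVM A ι) : E.observable (fun _ => 1) = 1 := by
  simp only [observable, Complex.ofReal_one, one_smul, E.sum_eq_one]

theorem POVM.posSemidef_observable (E : POVM A ι) {α : A → ℝ} (hα : ∀ a, 0 ≤ α a) :
    (E.observable α).PosSemidef :=
  posSemidef_sum _ fun a _ => (E.posSemidef a).smul (Complex.zero_le_real.2 (hα a))

theorem POVM.posSemidef_one_sub_observable (E : POVM A ι) {α : A → ℝ} (hα : ∀ a, |α a| ≤ 1) :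
    (1 - E.observable α).PosSemidef := by
  have h : 1 - E.observable α = E.observable fun a => 1 - α a := by
    simp [observable, sub_smul, E.sum_eq_one]
  exact h ▸ E.posSemidef_observable fun a => sub_nonneg.2 (le_of_abs_le (hα a))

theorem POVM.posSemidef_one_add_observable (E : POVM A ι) {α : A → ℝ} (hα : ∀ a, |α a| ≤ 1) :
    (1 + E.observable α).PosSemidef := by
  have h : 1 + E.observable α = 1 - E.observable (-α) := by
    simp [observable]
  exact h ▸ E.posSemidef_one_sub_observable fun a => by simpa using hα a

end Observable

section Correlation

theorem sub_kronecker {R l m n p : Type*} [NonUnitalNonAssocRing R] (X Y : Matrix l m R)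
    (Z : Matrix n p R) : (X - Y) ⊗ₖ Z = X ⊗ₖ Z - Y ⊗ₖ Z := by
  ext
  simp [sub_mul]

theorem kronecker_sub {R l m n p : Type*} [NonUnitalNonAssocRing R] (X : Matrix l m R)
    (Y Z : Matrix n p R) : X ⊗ₖ (Y - Z) = X ⊗ₖ Y - X ⊗ₖ Z := by
  ext
  simp [mul_sub]

variable {S T A B ι κ : Type*} [Fintype A] [Fintype B]
  [Fintype ι] [DecidableEq ι] [Fintype κ] [DecidableEq κ]

/-- The matrix of the expectations of `α a * β b`, where `a` and `b` are the answers. -/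
noncomputable def QuantumStrategy.correlation (σ : QuantumStrategy S T A B ι κ) (α : A → ℝ)
    (β : B → ℝ) : Matrix S T ℝ :=
  of fun s t => ∑ a, ∑ b, α a * β b * σ.answerProb s t a b

theorem QuantumStrategy.correlation_apply (σ : QuantumStrategy S T A B ι κ) (α : A → ℝ)
    (β : B → ℝ) (s : S) (t : T) :
    σ.correlation α β s t =
      (star σ.state ⬝ᵥ (((σ.alice s).observable α ⊗ₖ (σ.bob t).observable β) *ᵥ σ.state)).re := by
  have h : (σ.alice s).observable α ⊗ₖ (σ.bob t).observable β =
      ∑ a, ∑ b, ((α a * β b : ℝ) : ℂ) • ((σ.alice s).effect a ⊗ₖ (σ.bob t).effect b) := by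
    ext i j
    simp only [POVM.observable, kroneckerMap_apply, Matrix.sum_apply, Matrix.smul_apply,
      smul_eq_mul, Finset.sum_mul_sum]
    exact Finset.sum_congr rfl fun _ _ => Finset.sum_congr rfl fun _ _ => by push_cast; ring
  simp only [h, sum_mulVec, dotProduct_sum, smul_mulVec, dotProduct_smul, Complex.re_sum,
    smul_eq_mul, Complex.re_ofReal_mul, answerProb, correlation, of_apply]

theorem QuantumStrategy.sum_answerProb (σ : QuantumStrategy S T A B ι κ) (s : S) (t : T) :
    ∑ a, ∑ b, σ.answerProb s t a b = 1 := by
  simpa [correlation, POVM.observable_const_one, σ.state_unit] using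
    σ.correlation_apply (fun _ => 1) (fun _ => 1) s t

theorem QuantumStrategy.norm_state (σ : QuantumStrategy S T A B ι κ) : ‖toLp 2 σ.state‖ = 1 := by
  rw [← pow_eq_one_iff_of_nonneg (norm_nonneg _) two_ne_zero, norm_toLp_sq, σ.state_unit,
    RCLike.one_re]

theorem QuantumStrategy.exists_correlation_eq_inner (σ : QuantumStrategy S T A B ι κ)
    {α : A → ℝ} {β : B → ℝ} (hα : ∀ a, |α a| ≤ 1) (hβ : ∀ b, |β b| ≤ 1) :
    ∃ (u : S → EuclideanSpace ℂ (ι × κ)) (v : T → EuclideanSpace ℂ (ι × κ)),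
      (∀ s, ‖u s‖ ≤ 1) ∧ (∀ t, ‖v t‖ ≤ 1) ∧
        σ.correlation α β = of fun s t => (inner ℂ (u s) (v t)).re := by
  refine ⟨fun s => toLp 2 (((σ.alice s).observable α ⊗ₖ (1 : Matrix κ κ ℂ)) *ᵥ σ.state),
    fun t => toLp 2 (((1 : Matrix ι ι ℂ) ⊗ₖ (σ.bob t).observable β) *ᵥ σ.state),
    fun s => ?_, fun t => ?_, ?_⟩
  · have h₁ := ((σ.alice s).posSemidef_one_sub_observable hα).kronecker
      (PosSemidef.one (n := κ) (R := ℂ))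
    have h₂ := ((σ.alice s).posSemidef_one_add_observable hα).kronecker
      (PosSemidef.one (n := κ) (R := ℂ))
    rw [sub_kronecker, one_kronecker_one] at h₁
    rw [add_kronecker, one_kronecker_one] at h₂
    exact (norm_toLp_mulVec_le h₁ h₂ _).trans_eq σ.norm_state
  · have h₁ := (PosSemidef.one (n := ι) (R := ℂ)).kronecker
      ((σ.bob t).posSemidef_one_sub_observable hβ)
    have h₂ := (PosSemidef.one (n := ι) (R := ℂ)).kronecker
      ((σ.bob t).posSemidef_one_add_observable hβ)
    rw [kronecker_sub, one_kronecker_one] at h₁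
    rw [kronecker_add, one_kronecker_one] at h₂
    exact (norm_toLp_mulVec_le h₁ h₂ _).trans_eq σ.norm_state
  · ext s t
    have hX : ((σ.alice s).observable α ⊗ₖ (1 : Matrix κ κ ℂ))ᴴ =
        (σ.alice s).observable α ⊗ₖ 1 := by
      rw [conjTranspose_kronecker, conjTranspose_one, (σ.alice s).isHermitian_observable α]
    rw [of_apply, EuclideanSpace.inner_toLp_toLp, dotProduct_comm, star_mulVec, hX,
      ← dotProduct_mulVec, mulVec_mulVec, ← mul_kronecker_mul, mul_one, one_mul,
      σ.correlation_apply]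

variable [Fintype S] [Fintype T] [DecidableEq S] [DecidableEq T]

theorem IsDualBound.correlationValue_correlation_le {C : Matrix S T ℝ} {e : ℝ}
    (h : IsDualBound C e) (σ : QuantumStrategy S T A B ι κ) {α : A → ℝ} {β : B → ℝ}
    (hα : ∀ a, |α a| ≤ 1) (hβ : ∀ b, |β b| ≤ 1) : correlationValue C (σ.correlation α β) ≤ e := by
  obtain ⟨u, v, hu, hv, huv⟩ := σ.exists_correlation_eq_inner hα hβ
  rw [huv]
  exact h.correlationValue_re_inner_le (𝕜 := ℂ) hu hv

end Correlation

section XORGame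

/-- The sign `(-1) ^ b` of a bit. -/
def bitSign (b : Bool) : ℝ := if b then -1 else 1

theorem abs_bitSign (b : Bool) : |bitSign b| = 1 := by cases b <;> simp [bitSign]

theorem ite_xor_eq_bitSign (a b c : Bool) :
    (if Bool.xor a b = c then 1 else 0 : ℝ) = (1 + bitSign c * (bitSign a * bitSign b)) / 2 := by
  cases a <;> cases b <;> cases c <;> simp [bitSign]

/-- The character `a ↦ (-1) ^ (∑ j ∈ M, a j)` of the group of bit strings. -/
def bitChar {J : Type*} (M : Finset J) (a : J → Bool) : ℝ := ∏ j ∈ M, bitSign (a j)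

theorem abs_bitChar {J : Type*} (M : Finset J) (a : J → Bool) : |bitChar M a| = 1 := by
  simp only [bitChar, Finset.abs_prod, abs_bitSign, Finset.prod_const_one]

theorem ite_forall_xor_eq_bitChar {J : Type*} [Fintype J] (a b c : J → Bool)
    [Decidable (∀ j, Bool.xor (a j) (b j) = c j)] :
    (if ∀ j, Bool.xor (a j) (b j) = c j then 1 else 0 : ℝ) =
      (∑ M, bitChar M c * (bitChar M a * bitChar M b)) / 2 ^ Fintype.card J := by
  calc (if ∀ j, Bool.xor (a j) (b j) = c j then 1 else 0 : ℝ)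
      = ∏ j, (1 + bitSign (c j) * (bitSign (a j) * bitSign (b j))) / 2 := by
        simp only [← ite_xor_eq_bitSign, Finset.prod_ite_zero, Finset.mem_univ, forall_const,
          Finset.prod_const_one]
    _ = _ := by
      classical
      simp only [Finset.prod_div_distrib, Finset.prod_one_add, Finset.powerset_univ,
        Finset.prod_mul_distrib, Finset.prod_const, Finset.card_univ, bitChar]

theorem QuantumStrategy.successProb_eq_sum_correlationValue {S T A B ι κ K : Type*} [Fintype S]
    [Fintype T] [Fintype A] [Fintype B] [Fintype ι] [DecidableEq ι] [Fintype κ] [DecidableEq κ]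
    [Fintype K] (σ : QuantumStrategy S T A B ι κ) (G : TwoPlayerGame S T A B) {c : ℝ}
    {w : K → S → T → ℝ} {α : K → A → ℝ} {β : K → B → ℝ}
    (h : ∀ s t a b, (if G.accept s t a b = true then 1 else 0 : ℝ) =
      (∑ k, w k s t * (α k a * β k b)) / c) :
    σ.successProb G =
      (∑ k, correlationValue (of fun s t => G.prob s t * w k s t)
        (σ.correlation (α k) (β k))) / c := by
  have haccept (s t) : ∑ a, ∑ b, (if G.accept s t a b = true then σ.answerProb s t a b else 0) =
      (∑ k, w k s t * σ.correlation (α k) (β k) s t) / c := by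
    have hite (a b) : (if G.accept s t a b = true then σ.answerProb s t a b else 0) =
        (∑ k, w k s t * (α k a * β k b * σ.answerProb s t a b)) / c := by
      rw [← one_mul (σ.answerProb s t a b), ← zero_mul (σ.answerProb s t a b), ← ite_mul, h]
      simp only [one_mul, Finset.sum_mul, div_mul_eq_mul_div, mul_assoc]
    simp only [hite, ← Finset.sum_div]
    rw [Finset.sum_comm_cycle]
    simp only [← Finset.mul_sum, correlation, of_apply]
  simp only [successProb, haccept, mul_div_assoc', ← Finset.sum_div, Finset.mul_sum]
  rw [Finset.sum_comm_cycle]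
  simp only [correlationValue, of_apply, mul_assoc]

variable {S T : Type*} [Fintype S] [Fintype T]

/-- The cost matrix `π(s, t) (-1) ^ f(s, t)` of an XOR game. -/
def XORGame.cost (G : XORGame S T) : Matrix S T ℝ :=
  of fun s t => G.prob s t * bitSign (G.f s t)

/-- The quantum bias of an XOR game, the optimal difference of the probabilities of winning and of
losing, as given by Tsirelson's vector program. -/
noncomputable def XORGame.bias (G : XORGame S T) : ℝ := maxCorrelation G.cost

variable {ι κ : Type*} [Fintype ι] [DecidableEq ι] [Fintype κ] [DecidableEq κ]

theorem QuantumStrategy.successProb_toGame (σ : QuantumStrategy S T Bool Bool ι κ)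
    (G : XORGame S T) :
    σ.successProb G.toGame =
      (1 + correlationValue G.cost (σ.correlation bitSign bitSign)) / 2 := by
  rw [σ.successProb_eq_sum_correlationValue G.toGame (c := 2)
    (w := ![fun _ _ => 1, fun s t => bitSign (G.f s t)]) (α := ![fun _ => 1, bitSign])
    (β := ![fun _ => 1, bitSign]) fun s t a b => by
      simp [XORGame.toGame, ite_xor_eq_bitSign], Fin.sum_univ_two]
  congr 2
  simp only [correlationValue, correlation, of_apply, cons_val_zero, mul_one, one_mul,
    σ.sum_answerProb, XORGame.toGame, G.prob_sum]

theorem QuantumStrategy.successProb_toGame_le (σ : QuantumStrategy S T Bool Bool ι κ)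
    (G : XORGame S T) : σ.successProb G.toGame ≤ (1 + G.bias) / 2 := by
  classical
  rw [σ.successProb_toGame]
  gcongr
  exact (isDualBound_maxCorrelation G.cost).correlationValue_correlation_le σ
    (fun a => (abs_bitSign a).le) fun b => (abs_bitSign b).le

end XORGame

section Tsirelson

theorem exists_clifford_linearMap (N : ℕ) :
    ∃ (ι : Type) (_ : Fintype ι) (_ : DecidableEq ι) (_ : Nonempty ι)
      (γ : (Fin N → ℝ) →ₗ[ℝ] Matrix ι ι ℂ),
      (∀ v, (γ v).IsHermitian) ∧ ∀ v, γ v * γ v = (v ⬝ᵥ v) • 1 := by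
  induction N with
  | zero => exact ⟨Unit, inferInstance, inferInstance, inferInstance, 0, by simp, by simp⟩
  | succ N ih =>
    obtain ⟨ι, _, _, _, γ, hherm, hsq⟩ := ih
    let γ' : (Fin (N + 1) → ℝ) →ₗ[ℝ] Matrix (ι ⊕ ι) (ι ⊕ ι) ℂ :=
      { toFun v := fromBlocks (γ (vecTail v)) (v 0 • 1) (v 0 • 1) (-γ (vecTail v))
        map_add' v w := by
          simp only [tail_add, map_add, Pi.add_apply, add_smul, neg_add, fromBlocks_add]
        map_smul' r v := by
          have htail : vecTail (r • v) = r • vecTail v := rfl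
          simp only [htail, map_smul, Pi.smul_apply, smul_assoc, fromBlocks_smul, smul_neg,
            RingHom.id_apply] }
    refine ⟨ι ⊕ ι, inferInstance, inferInstance, inferInstance, γ', fun v => ?_, fun v => ?_⟩
    · simp [γ', IsHermitian, fromBlocks_conjTranspose, (hherm _).eq]
    · have hdot : v ⬝ᵥ v = v 0 * v 0 + vecTail v ⬝ᵥ vecTail v := Fin.sum_univ_succ _
      simp only [γ', LinearMap.coe_mk, AddHom.coe_mk, fromBlocks_multiply, neg_mul_neg, hsq,
        hdot, ← fromBlocks_one, fromBlocks_smul]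
      simp [add_smul, mul_smul, add_comm]

theorem trace_mul_of_mul_self_eq {N ι : Type*} [Fintype N] [Fintype ι] [DecidableEq ι]
    {γ : (N → ℝ) →ₗ[ℝ] Matrix ι ι ℂ} (hγ : ∀ v, γ v * γ v = (v ⬝ᵥ v) • 1) (v w : N → ℝ) :
    (γ v * γ w).trace = (v ⬝ᵥ w : ℝ) * Fintype.card ι := by
  have htrace (x) : (γ x * γ x).trace = (x ⬝ᵥ x : ℝ) * Fintype.card ι := by
    rw [hγ, trace_smul, trace_one, Complex.real_smul]
  have h := htrace (v + w)
  simp only [map_add, add_mul, mul_add, trace_add, htrace, add_dotProduct, dotProduct_add,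
    trace_mul_comm (γ w) (γ v), dotProduct_comm w v, Complex.ofReal_add] at h
  linear_combination h / 2

theorem exists_dotProduct_eq_of_posSemidef {m : Type*} [Finite m] {R : Matrix m m ℝ}
    (hR : R.PosSemidef) : ∃ (N : ℕ) (x : m → Fin N → ℝ), ∀ a b, x a ⬝ᵥ x b = R a b := by
  obtain ⟨N, v, rfl⟩ := posSemidef_iff_eq_sum_vecMulVec.1 hR
  exact ⟨N, fun a i => v i a, fun a b => by
    simp [dotProduct, Matrix.sum_apply, vecMulVec_apply]⟩

theorem exists_involutions_of_mem_correlationMatrices {m : Type*} [Finite m] {R : Matrix m m ℝ}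
    (hR : R ∈ correlationMatrices m) :
    ∃ (ι : Type) (_ : Fintype ι) (_ : DecidableEq ι) (_ : Nonempty ι) (X : m → Matrix ι ι ℂ),
      (∀ a, (X a).IsHermitian) ∧ (∀ a, X a * X a = 1) ∧
        ∀ a b, (X a * X b).trace = R a b * Fintype.card ι := by
  obtain ⟨N, x, hx⟩ := exists_dotProduct_eq_of_posSemidef hR.1
  obtain ⟨ι, _, _, _, γ, hherm, hsq⟩ := exists_clifford_linearMap N
  refine ⟨ι, inferInstance, inferInstance, inferInstance, fun a => γ (x a), fun a => hherm _,
    fun a => ?_, fun a b => ?_⟩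
  · rw [hsq, hx, hR.2, one_smul]
  · rw [trace_mul_of_mul_self_eq hsq, hx]

variable {ι : Type*} [Fintype ι] [DecidableEq ι]

theorem posSemidef_one_add_of_mul_self {X : Matrix ι ι ℂ} (hX : X.IsHermitian)
    (hXX : X * X = 1) : (1 + X).PosSemidef := by
  have h : 1 + X = (2⁻¹ : ℂ) • ((1 + X)ᴴ * (1 + X)) := by
    rw [(isHermitian_one.add hX).eq, add_mul, mul_add, mul_add, hXX, one_mul, one_mul, mul_one]
    module
  exact h ▸ (posSemidef_conjTranspose_mul_self _).smul (by positivity)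

/-- The measurement of an observable with eigenvalues `±1`: the outcome `a` is the projection onto
the eigenspace of `(-1) ^ a`. -/
noncomputable def POVM.ofInvolution (X : Matrix ι ι ℂ) (hX : X.IsHermitian) (hXX : X * X = 1) :
    POVM Bool ι where
  effect a := (2⁻¹ : ℂ) • (1 + bitSign a • X)
  posSemidef a := by
    refine (posSemidef_one_add_of_mul_self ?_ ?_).smul (by positivity)
    · simp [IsHermitian, hX.eq]
    · cases a <;> simp [bitSign, hXX]
  sum_eq_one := by
    simp only [Fintype.sum_bool, bitSign, if_true, Bool.false_eq_true, if_false]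
    module

theorem POVM.observable_ofInvolution (X : Matrix ι ι ℂ) (hX : X.IsHermitian) (hXX : X * X = 1) :
    (POVM.ofInvolution X hX hXX).observable bitSign = X := by
  simp only [POVM.observable, POVM.ofInvolution, Fintype.sum_bool, bitSign, if_true,
    Bool.false_eq_true, if_false, Complex.ofReal_neg, Complex.ofReal_one]
  module

/-- The maximally entangled state, shared in Tsirelson's optimal strategies. -/
noncomputable def maxEntangled (ι : Type*) [Fintype ι] [DecidableEq ι] : ι × ι → ℂ :=
  (√(Fintype.card ι))⁻¹ • vec 1

theorem star_maxEntangled_dotProduct_kronecker_mulVec (X Y : Matrix ι ι ℂ) :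
    star (maxEntangled ι) ⬝ᵥ ((X ⊗ₖ Y) *ᵥ maxEntangled ι) =
      (Y * Xᵀ).trace / Fintype.card ι := by
  have hcard : ((√(Fintype.card ι) : ℝ) : ℂ) * (√(Fintype.card ι) : ℝ) = Fintype.card ι := by
    rw [← Complex.ofReal_mul, Real.mul_self_sqrt (Nat.cast_nonneg _), Complex.ofReal_natCast]
  simp only [maxEntangled, star_smul, star_trivial, smul_dotProduct, mulVec_smul, dotProduct_smul,
    kronecker_mulVec_vec, star_vec_dotProduct_vec, conjTranspose_one, one_mul, mul_one]
  rw [smul_smul, ← mul_inv, Complex.real_smul, Complex.ofReal_inv, Complex.ofReal_mul, hcard,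
    inv_mul_eq_div]

theorem star_maxEntangled_dotProduct_self [Nonempty ι] :
    star (maxEntangled ι) ⬝ᵥ maxEntangled ι = 1 := by
  have h := star_maxEntangled_dotProduct_kronecker_mulVec (1 : Matrix ι ι ℂ) 1
  rwa [one_kronecker_one, one_mulVec, transpose_one, mul_one, trace_one,
    div_self (Nat.cast_ne_zero.2 Fintype.card_ne_zero)] at h

variable {S T : Type*}

theorem exists_correlation_eq_toBlocks₁₂ [Finite S] [Finite T]
    {R : Matrix (S ⊕ T) (S ⊕ T) ℝ}
    (hR : R ∈ correlationMatrices (S ⊕ T)) :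
    ∃ (ι : Type) (_ : Fintype ι) (_ : DecidableEq ι) (σ : QuantumStrategy S T Bool Bool ι ι),
      σ.correlation bitSign bitSign = R.toBlocks₁₂ := by
  obtain ⟨ι, _, _, _, X, hherm, hsq, htrace⟩ := exists_involutions_of_mem_correlationMatrices hR
  refine ⟨ι, inferInstance, inferInstance,
    { state := maxEntangled ι
      state_unit := star_maxEntangled_dotProduct_self
      alice := fun s => POVM.ofInvolution (X (.inl s))ᵀ (hherm _).transpose
        (by rw [← transpose_mul, hsq, transpose_one])
      bob := fun t => POVM.ofInvolution (X (.inr t)) (hherm _) (hsq _) }, ?_⟩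
  ext s t
  rw [QuantumStrategy.correlation_apply]
  simp only [POVM.observable_ofInvolution]
  rw [star_maxEntangled_dotProduct_kronecker_mulVec, transpose_transpose, trace_mul_comm, htrace,
    mul_div_cancel_right₀ _ (Nat.cast_ne_zero.2 Fintype.card_ne_zero), Complex.ofReal_re]
  rfl

theorem XORGame.isGreatest_quantumSuccessProbs [Fintype S] [Fintype T] (G : XORGame S T) :
    IsGreatest G.toGame.quantumSuccessProbs ((1 + G.bias) / 2) := by
  constructor
  · obtain ⟨R, hR, hvalue, -⟩ := exists_correlationValue_eq_maxCorrelation G.cost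
    obtain ⟨ι, _, _, σ, hσ⟩ := exists_correlation_eq_toBlocks₁₂ hR
    exact ⟨ι, ι, _, _, _, _, σ, by rw [σ.successProb_toGame, hσ, hvalue, XORGame.bias]⟩
  · rintro _ ⟨ι, κ, _, _, _, _, σ, rfl⟩
    exact σ.successProb_toGame_le G

end Tsirelson

section ProductStrategy

variable {J : Type*} [Fintype J] {ι κ : J → Type*} [∀ j, Fintype (ι j)] [∀ j, Fintype (κ j)]

/-- The tensor product of a family of bipartite states, with the parts of each player grouped
together. -/
def piState (ψ : ∀ j, ι j × κ j → ℂ) : (∀ j, ι j) × (∀ j, κ j) → ℂ :=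
  fun x => ∏ j, ψ j (x.1 j, x.2 j)

variable [DecidableEq J]

theorem star_piState_dotProduct_mulVec (ψ : ∀ j, ι j × κ j → ℂ) (X : ∀ j, Matrix (ι j) (ι j) ℂ)
    (Y : ∀ j, Matrix (κ j) (κ j) ℂ) :
    star (piState ψ) ⬝ᵥ ((piKronecker X ⊗ₖ piKronecker Y) *ᵥ piState ψ) =
      ∏ j, star (ψ j) ⬝ᵥ ((X j ⊗ₖ Y j) *ᵥ ψ j) := by
  simp only [dotProduct, mulVec, Fintype.sum_prod_type, Finset.mul_sum, Pi.star_apply,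
    kroneckerMap_apply, Fintype.prod_sum, piState, piKronecker_apply, star_prod,
    Finset.prod_mul_distrib]

variable [∀ j, DecidableEq (ι j)] [∀ j, DecidableEq (κ j)]

/-- The measurement performing independent measurements on the factors of a tensor product. -/
noncomputable def POVM.pi {A : J → Type*} [∀ j, Fintype (A j)] (E : ∀ j, POVM (A j) (ι j)) :
    POVM (∀ j, A j) (∀ j, ι j) where
  effect a := piKronecker fun j => (E j).effect (a j)
  posSemidef a := posSemidef_piKronecker fun j => (E j).posSemidef (a j)
  sum_eq_one := by
    rw [sum_piKronecker fun j => (E j).effect]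
    simp only [(E _).sum_eq_one, piKronecker_one]

variable {S T A B : J → Type*} [∀ j, Fintype (A j)] [∀ j, Fintype (B j)]

/-- The strategy playing a family of strategies independently. -/
noncomputable def QuantumStrategy.pi
    (σ : ∀ j, QuantumStrategy (S j) (T j) (A j) (B j) (ι j) (κ j)) :
    QuantumStrategy (∀ j, S j) (∀ j, T j) (∀ j, A j) (∀ j, B j) (∀ j, ι j) (∀ j, κ j) where
  state := piState fun j => (σ j).state
  state_unit := by
    simpa [piKronecker_one, (σ _).state_unit] using
      star_piState_dotProduct_mulVec (fun j => (σ j).state) (fun _ => 1) (fun _ => 1)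
  alice s := POVM.pi fun j => (σ j).alice (s j)
  bob t := POVM.pi fun j => (σ j).bob (t j)

theorem QuantumStrategy.ofReal_answerProb {S T A B ι κ : Type*} [Fintype A] [Fintype B]
    [Fintype ι] [DecidableEq ι] [Fintype κ] [DecidableEq κ] (σ : QuantumStrategy S T A B ι κ)
    (s : S) (t : T) (a : A) (b : B) :
    (σ.answerProb s t a b : ℂ) =
      star σ.state ⬝ᵥ (((σ.alice s).effect a ⊗ₖ (σ.bob t).effect b) *ᵥ σ.state) := by
  have h := (((σ.alice s).posSemidef a).kronecker
    ((σ.bob t).posSemidef b)).dotProduct_mulVec_nonneg σ.state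
  exact (Complex.eq_re_of_ofReal_le h).symm

theorem QuantumStrategy.answerProb_pi
    (σ : ∀ j, QuantumStrategy (S j) (T j) (A j) (B j) (ι j) (κ j)) (s : ∀ j, S j) (t : ∀ j, T j)
    (a : ∀ j, A j) (b : ∀ j, B j) :
    (QuantumStrategy.pi σ).answerProb s t a b = ∏ j, (σ j).answerProb (s j) (t j) (a j) (b j) := by
  apply Complex.ofReal_injective
  simp only [Complex.ofReal_prod, QuantumStrategy.ofReal_answerProb]
  exact star_piState_dotProduct_mulVec _ _ _

end ProductStrategy

section SubsetCost

variable {J : Type*} [Fintype J] [DecidableEq J] {S T : J → Type*} [∀ j, Fintype (S j)]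
  [∀ j, Fintype (T j)]

/-- The cost matrix of the XOR of the games `G j` with `j ∈ M`, where the questions of the other
games are drawn but ignored. -/
def subsetCost (G : ∀ j, XORGame (S j) (T j)) (M : Finset J) :
    Matrix (∀ j, S j) (∀ j, T j) ℝ :=
  piKronecker fun j => if j ∈ M then (G j).cost else of (G j).prob

theorem subsetCost_apply (G : ∀ j, XORGame (S j) (T j)) (M : Finset J) (s : ∀ j, S j)
    (t : ∀ j, T j) :
    subsetCost G M s t =
      (∏ j, (G j).prob (s j) (t j)) * bitChar M fun j => (G j).f (s j) (t j) := by
  have h (j) : (if j ∈ M then (G j).cost else of (G j).prob) (s j) (t j) =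
      (G j).prob (s j) (t j) * if j ∈ M then bitSign ((G j).f (s j) (t j)) else 1 := by
    split_ifs <;> simp [XORGame.cost]
  simp only [subsetCost, piKronecker_apply, h, Finset.prod_mul_distrib, Finset.prod_ite_mem,
    Finset.univ_inter, bitChar]

theorem isDualBound_subsetCost [∀ j, DecidableEq (S j)] [∀ j, DecidableEq (T j)]
    (G : ∀ j, XORGame (S j) (T j)) (M : Finset J) :
    IsDualBound (subsetCost G M) (∏ j ∈ M, (G j).bias) := by
  have h (j) : IsDualBound (if j ∈ M then (G j).cost else of (G j).prob)
      (if j ∈ M then (G j).bias else 1) := by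
    split_ifs
    · exact isDualBound_maxCorrelation _
    · exact (G j).prob_sum ▸ isDualBound_sum_of_nonneg (G j).prob_nonneg
  simpa only [subsetCost, Finset.prod_ite_mem, Finset.univ_inter] using IsDualBound.piKronecker h

end SubsetCost

section Conjunction

variable {n : ℕ} {S T : Fin n → Type*} [∀ j, Fintype (S j)] [∀ j, Fintype (T j)]
  {ι κ : Type*} [Fintype ι] [DecidableEq ι] [Fintype κ] [DecidableEq κ]

theorem QuantumStrategy.successProb_conjunction
    (σ : QuantumStrategy (∀ j, S j) (∀ j, T j) (Fin n → Bool) (Fin n → Bool) ι κ)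
    (G : ∀ j, XORGame (S j) (T j)) :
    σ.successProb (XORGame.conjunction G) =
      (∑ M, correlationValue (subsetCost G M) (σ.correlation (bitChar M) (bitChar M))) / 2 ^ n := by
  rw [σ.successProb_eq_sum_correlationValue (XORGame.conjunction G) (c := 2 ^ n)
    (w := fun M s t => bitChar M fun j => (G j).f (s j) (t j)) (α := bitChar) (β := bitChar)
    fun s t a b => by
      simpa only [XORGame.conjunction, decide_eq_true_eq, Fintype.card_fin] using
        ite_forall_xor_eq_bitChar a b fun j => (G j).f (s j) (t j)]
  congr! with M
  ext s t
  exact (subsetCost_apply G M s t).symm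

theorem QuantumStrategy.successProb_conjunction_le
    (σ : QuantumStrategy (∀ j, S j) (∀ j, T j) (Fin n → Bool) (Fin n → Bool) ι κ)
    (G : ∀ j, XORGame (S j) (T j)) :
    σ.successProb (XORGame.conjunction G) ≤ ∏ j, (1 + (G j).bias) / 2 := by
  classical
  calc σ.successProb (XORGame.conjunction G)
      = (∑ M, correlationValue (subsetCost G M) (σ.correlation (bitChar M) (bitChar M))) / 2 ^ n :=
        σ.successProb_conjunction G
    _ ≤ (∑ M, ∏ j ∈ M, (G j).bias) / 2 ^ n := by
      gcongr with M
      exact (isDualBound_subsetCost G M).correlationValue_correlation_le σ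
        (fun a => (abs_bitChar M a).le) fun b => (abs_bitChar M b).le
    _ = ∏ j, (1 + (G j).bias) / 2 := by
      simp only [Finset.prod_div_distrib, Finset.prod_one_add, Finset.powerset_univ,
        Finset.prod_const, Finset.card_univ, Fintype.card_fin]

theorem QuantumStrategy.successProb_pi {ι κ : Fin n → Type*} [∀ j, Fintype (ι j)]
    [∀ j, DecidableEq (ι j)] [∀ j, Fintype (κ j)] [∀ j, DecidableEq (κ j)]
    (σ : ∀ j, QuantumStrategy (S j) (T j) Bool Bool (ι j) (κ j))
    (G : ∀ j, XORGame (S j) (T j)) :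
    (QuantumStrategy.pi σ).successProb (XORGame.conjunction G) =
      ∏ j, (σ j).successProb (G j).toGame := by
  have h (s t a b) : (if (XORGame.conjunction G).accept s t a b = true then
      (QuantumStrategy.pi σ).answerProb s t a b else 0) =
      ∏ j, if (G j).toGame.accept (s j) (t j) (a j) (b j) = true then
        (σ j).answerProb (s j) (t j) (a j) (b j) else 0 := by
    simp [Finset.prod_ite_zero, QuantumStrategy.answerProb_pi, XORGame.conjunction, XORGame.toGame]
  simp only [QuantumStrategy.successProb, h, Fintype.prod_sum, Finset.prod_mul_distrib]
  rfl

theorem XORGame.isGreatest_quantumSuccessProbs_conjunction (G : ∀ j, XORGame (S j) (T j)) :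
    IsGreatest (XORGame.conjunction G).quantumSuccessProbs (∏ j, (1 + (G j).bias) / 2) := by
  constructor
  · choose ι κ _ _ _ _ σ hσ using fun j => (G j).isGreatest_quantumSuccessProbs.1
    exact ⟨∀ j, ι j, ∀ j, κ j, inferInstance, inferInstance, inferInstance, inferInstance,
      QuantumStrategy.pi σ, by simp only [QuantumStrategy.successProb_pi, hσ]⟩
  · rintro _ ⟨ι, κ, _, _, _, _, σ, rfl⟩
    exact σ.successProb_conjunction_le G

end Conjunction

/-- The quantum values are maxima (they are attained), and the quantum value of the conjunction is
the product of the quantum values of the games. -/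
theorem theorem2 {n : ℕ} {S T : Fin n → Type*} [∀ j, Fintype (S j)] [∀ j, Fintype (T j)]
    (G : ∀ j, XORGame (S j) (T j)) :
    (∀ j, IsGreatest (G j).toGame.quantumSuccessProbs (G j).toGame.quantumValue) ∧
    IsGreatest (XORGame.conjunction G).quantumSuccessProbs
      (XORGame.conjunction G).quantumValue ∧
    (XORGame.conjunction G).quantumValue = ∏ j, (G j).toGame.quantumValue := by
  have hgame (j) := (G j).isGreatest_quantumSuccessProbs
  have hconj := XORGame.isGreatest_quantumSuccessProbs_conjunction G
  have hvalue (j) : (G j).toGame.quantumValue = (1 + (G j).bias) / 2 := (hgame j).csSup_eq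
  have hvalue_conj : (XORGame.conjunction G).quantumValue = ∏ j, (1 + (G j).bias) / 2 :=
    hconj.csSup_eq
  simp only [hvalue, hvalue_conj]
  exact ⟨hgame, hconj, trivial⟩
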